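/- There exist universal constants $c_1, c_2 > 0$ (independent of $n$, $K$ and $\delta$) such that the following holds. Let $K \subset \mathbb{R}^n$ be a convex body (a compact convex set with non-empty interior) which is symmetric ($x \in K$ implies $-x \in K$) and has volume $|K| = 1$. For $\delta \in (0, \tfrac12)$ let $$K_\delta = \bigcap_{\theta \in S^{n-1}} \{x \in K : |\langle x, \theta\rangle| \le t_\theta\}, \qquad t_\theta = \sup\{t > 0 : |\{x \in K : |\langle x, \theta\rangle| \le t\}| = 1-\delta\},$$ be the floating body of $K$, and let $$\Lambda_K^*(x) = \sup_{u \in \mathbb{R}^n} \Big\{ \langle x, u\rangle - \log \int_K e^{\langle y, u\rangle}\, dy \Big\} \in [0, \infty], \qquad x \in \mathbb{R}^n,$$ be the Legendre transform of the logarithmic Laplace transform of $K$. Then for every $\delta \in (0, \tfrac12)$, $$c_1 \Big\{x \in \mathbb{R}^n : \Lambda_K^*(x) \le \log\tfrac1\delta\Big\} \subseteq K_\delta \subseteq c_2 \Big\{x \in \mathbb{R}^n : \Lambda_K^*(x) \le \log\tfrac1\delta\Big\}.$$ -/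

import Mathlib

open MeasureTheory
open scoped Pointwise

/-- The number `t_θ = sup {t > 0 : |{x ∈ K : |⟨x, θ⟩| ≤ t}| = 1 - δ}`: the half-width of the
symmetric slab orthogonal to `θ` outside which `K` (of volume one) has volume `δ`. -/
noncomputable def floatingWidth {n : ℕ} (K : Set (EuclideanSpace ℝ (Fin n))) (δ : ℝ)
    (θ : EuclideanSpace ℝ (Fin n)) : ℝ :=
  sSup {t : ℝ | 0 < t ∧ volume {x | x ∈ K ∧ |inner ℝ x θ| ≤ t} = ENNReal.ofReal (1 - δ)}

/-- The floating body `K_δ` of a symmetric convex body `K` of volume one: the intersection over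
the unit sphere of the sets `{x ∈ K : |⟨x, θ⟩| ≤ t_θ}`. -/
noncomputable def floatingBody {n : ℕ} (K : Set (EuclideanSpace ℝ (Fin n))) (δ : ℝ) :
    Set (EuclideanSpace ℝ (Fin n)) :=
  ⋂ θ ∈ Metric.sphere (0 : EuclideanSpace ℝ (Fin n)) 1,
    {x | x ∈ K ∧ |inner ℝ x θ| ≤ floatingWidth K δ θ}

/-- The logarithmic Laplace transform `Λ_K(u) = log ∫_K exp ⟨y, u⟩ dy`. -/
noncomputable def logLaplace {n : ℕ} (K : Set (EuclideanSpace ℝ (Fin n)))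
    (u : EuclideanSpace ℝ (Fin n)) : ℝ :=
  Real.log (∫ y in K, Real.exp (inner ℝ y u))

/-- The Legendre transform `Λ_K^*(x) = sup_u (⟨x, u⟩ - Λ_K(u))`, a supremum in `[-∞, ∞]`. -/
noncomputable def logLaplaceLegendre {n : ℕ} (K : Set (EuclideanSpace ℝ (Fin n)))
    (x : EuclideanSpace ℝ (Fin n)) : EReal :=
  ⨆ u : EuclideanSpace ℝ (Fin n), ((inner ℝ x u - logLaplace K u : ℝ) : EReal)

/-- The level set `B_r(K) = {x : Λ_K^*(x) ≤ r}`. -/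
noncomputable def legendreLevelSet {n : ℕ} (K : Set (EuclideanSpace ℝ (Fin n))) (r : ℝ) :
    Set (EuclideanSpace ℝ (Fin n)) :=
  {x | logLaplaceLegendre K x ≤ (r : EReal)}

/-! Both inclusions are checked one direction `θ` at a time, with `T = t_θ` and `r = log (1/δ)`. By
symmetry the cap `{⟨x, θ⟩ ≥ T}` of `K` has volume `δ/2`, while the half-body `{⟨x, θ⟩ ≥ 0}` has
volume at least `1/2`.

Left inclusion: Prékopa–Leindler makes cap volumes midpoint log-concave
(`volume_convexCap_mul_le_sq`), so the drop by a factor `δ` from height `0` to `T` repeats and the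
cap at `kT` has volume at most `δ^k`. Summing over layers bounds `Λ_K` by `7r/2` at `u = (r/2T)θ`.
Testing `Λ_K^*(x) ≤ r` at this `u` gives `⟨x, θ⟩ ≤ 9T`. Membership in `K` itself comes from
Hahn–Banach.

Right inclusion: integrating over the cap alone gives `Λ_K(sθ) ≥ sT + log (δ/2)`, and symmetry gives
`Λ_K ≥ 0`. Together these bound `⟨x/2, sθ⟩ - Λ_K(sθ)` by `r` for every `x` in the floating body. -/

/-! ### Brunn–Minkowski on the line -/

theorem Real.volume_add_volume_le_of_isCompact {A B C : Set ℝ} (hA : IsCompact A) (hB : IsCompact B)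
    (hA0 : A.Nonempty) (hB0 : B.Nonempty)
    (h : ∀ a ∈ A, ∀ b ∈ B, (a + b) / 2 ∈ C) : volume A + volume B ≤ 2 * volume C := by
  obtain ⟨a, haA, ha⟩ := hA.exists_isGreatest hA0
  obtain ⟨b, hbB, hb⟩ := hB.exists_isLeast hB0
  have hD : volume ((fun x : ℝ => (2⁻¹ : ℝ) * x) ⁻¹' C) = 2 * volume C := by
    rw [Real.volume_preimage_mul_left (by norm_num)]
    norm_num
  -- The translates `A + min B` and `B + max A` both lie in `2C` and meet at most in the point `max
  -- A + min B`.
  have hAm : volume ((fun x : ℝ => x + -b) ⁻¹' A) = volume A := measure_preimage_add_right _ _ _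
  have hBm : volume ((fun x : ℝ => x + -a) ⁻¹' B) = volume B := measure_preimage_add_right _ _ _
  have hinter : volume (((fun x : ℝ => x + -b) ⁻¹' A) ∩ ((fun x : ℝ => x + -a) ⁻¹' B)) = 0 := by
    refine measure_mono_null (t := {a + b}) ?_ (by simp)
    rintro x ⟨hx1, hx2⟩
    have h1 := ha hx1
    have h2 := hb hx2
    simp only [Set.mem_singleton_iff]
    linarith
  have hmeas : MeasurableSet ((fun x : ℝ => x + -a) ⁻¹' B) :=
    hB.measurableSet.preimage (by fun_prop)
  rw [← hD, ← hAm, ← hBm, ← measure_union_add_inter _ hmeas, hinter, add_zero]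
  refine measure_mono (Set.union_subset ?_ ?_)
  · intro x hx
    have := h _ hx _ hbB
    simp only [Set.mem_preimage] at this ⊢
    convert this using 1
    ring
  · intro x hx
    have := h _ haA _ hx
    simp only [Set.mem_preimage] at this ⊢
    convert this using 1
    ring

/-- One-dimensional Brunn–Minkowski inequality for midpoints. -/
theorem Real.volume_add_volume_le {A B C : Set ℝ} (hA : MeasurableSet A) (hB : MeasurableSet B)
    (hA0 : A.Nonempty) (hB0 : B.Nonempty)
    (h : ∀ a ∈ A, ∀ b ∈ B, (a + b) / 2 ∈ C) : volume A + volume B ≤ 2 * volume C := by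
  obtain ⟨a, ha⟩ := hA0
  obtain ⟨b, hb⟩ := hB0
  rw [hA.measure_eq_iSup_isCompact, hB.measure_eq_iSup_isCompact]
  simp_rw [iSup_and']
  refine ENNReal.biSup_add_biSup_le' ⟨∅, by simp⟩ ⟨∅, by simp⟩ ?_
  rintro A' ⟨hA', hA'c⟩ B' ⟨hB', hB'c⟩
  -- Inserting `a` and `b` keeps the inner compact sets nonempty.
  refine (add_le_add (measure_mono (Set.subset_insert a A'))
    (measure_mono (Set.subset_insert b B'))).trans ?_
  refine Real.volume_add_volume_le_of_isCompact (hA'c.insert a) (hB'c.insert b) (by simp) (by simp)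
    fun x hx y hy => h x ?_ y ?_
  · rcases hx with rfl | hx
    exacts [ha, hA' hx]
  · rcases hy with rfl | hy
    exacts [hb, hB' hy]

/-! ### Midpoint Prékopa–Leindler inequality -/

theorem volume_setOf_ofReal_lt (a : ENNReal) :
    volume {t : ℝ | 0 < t ∧ ENNReal.ofReal t < a} = a := by
  rcases eq_or_ne a ⊤ with rfl | ha
  · have : {t : ℝ | 0 < t ∧ ENNReal.ofReal t < ⊤} = Set.Ioi 0 := by ext; simp
    rw [this, Real.volume_Ioi]
  · have : {t : ℝ | 0 < t ∧ ENNReal.ofReal t < a} = Set.Ioo 0 a.toReal := by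
      ext t
      simp only [Set.mem_ofPred_eq, Set.mem_Ioo, and_congr_right_iff]
      intro ht
      rw [ENNReal.ofReal_lt_iff_lt_toReal ht.le ha]
    rw [this, Real.volume_Ioo, sub_zero, ENNReal.ofReal_toReal ha]

/-- Layer-cake formula for functions with values in `[0, ∞]`. -/
theorem lintegral_eq_lintegral_volume_lt {α : Type*} [MeasurableSpace α] (μ : Measure α)
    [SFinite μ] {f : α → ENNReal} (hf : Measurable f) :
    ∫⁻ x, f x ∂μ = ∫⁻ t in Set.Ioi (0 : ℝ), μ {x | ENNReal.ofReal t < f x} := by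
  have hS : MeasurableSet {p : α × ℝ | 0 < p.2 ∧ ENNReal.ofReal p.2 < f p.1} :=
    (measurableSet_lt measurable_const measurable_snd).inter
      (measurableSet_lt (ENNReal.measurable_ofReal.comp measurable_snd) (hf.comp measurable_fst))
  have h1 := Measure.prod_apply (μ := μ) (ν := (volume : Measure ℝ)) hS
  have h2 := Measure.prod_apply_symm (μ := μ) (ν := (volume : Measure ℝ)) hS
  rw [h1] at h2
  simp only [Set.preimage_ofPred_eq, volume_setOf_ofReal_lt] at h2
  rw [h2, ← lintegral_indicator measurableSet_Ioi]
  refine lintegral_congr fun t => ?_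
  by_cases ht : 0 < t <;> simp [ht]

/-- The midpoint Prékopa–Leindler inequality for a measure `μ`. -/
def SatisfiesMidpointPrekopaLeindler {E : Type*} [AddCommGroup E] [Module ℝ E] [MeasurableSpace E]
    (μ : Measure E) : Prop :=
  ∀ f g h : E → ENNReal, Measurable f → Measurable g → Measurable h →
    (∀ x y, f x * g y ≤ h ((2⁻¹ : ℝ) • (x + y)) ^ 2) →
      (∫⁻ x, f x ∂μ) * (∫⁻ x, g x ∂μ) ≤ (∫⁻ x, h x ∂μ) ^ 2

theorem ENNReal.mul_le_sq_of_add_le_two_mul {a b c : ENNReal} (h : a + b ≤ 2 * c) :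
    a * b ≤ c ^ 2 := by
  rcases eq_or_ne c ⊤ with rfl | hc
  · simp
  have hab : a + b ≠ ⊤ := ne_top_of_le_ne_top (ENNReal.mul_ne_top (by simp) hc) h
  lift c to NNReal using hc
  lift a to NNReal using fun h => hab (by simp [h])
  lift b to NNReal using fun h => hab (by simp [h])
  norm_cast at *
  have h' : (a : ℝ) + b ≤ 2 * c := by exact_mod_cast h
  have : (a : ℝ) * b ≤ c ^ 2 := by
    nlinarith [sq_nonneg ((a : ℝ) - b), a.2, b.2, c.2]
  exact_mod_cast this

/-- Layer cake plus one-dimensional Brunn–Minkowski on superlevel sets. Equal suprema make the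
superlevel sets of `f` and `g` nonempty for the same levels `t < 1`; above that both are empty. -/
theorem lintegral_add_lintegral_le_of_iSup_eq_one {f g h : ℝ → ENNReal} (hf : Measurable f)
    (hg : Measurable g) (hh : Measurable h) (hf1 : ⨆ x, f x = 1) (hg1 : ⨆ x, g x = 1)
    (H : ∀ x y, f x * g y ≤ h ((2⁻¹ : ℝ) • (x + y)) ^ 2) :
    (∫⁻ x, f x) + (∫⁻ x, g x) ≤ 2 * ∫⁻ x, h x := by
  rw [lintegral_eq_lintegral_volume_lt _ hf, lintegral_eq_lintegral_volume_lt _ hg,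
    lintegral_eq_lintegral_volume_lt _ hh, ← lintegral_const_mul' _ _ (by simp),
    ← lintegral_add_left' ?_]
  · refine lintegral_mono fun t => ?_
    by_cases ht : ENNReal.ofReal t < 1
    · refine Real.volume_add_volume_le (measurableSet_lt (by fun_prop) (by fun_prop))
        (measurableSet_lt (by fun_prop) (by fun_prop)) ?_ ?_ ?_
      · rw [← hf1] at ht
        exact lt_iSup_iff.1 ht
      · rw [← hg1] at ht
        exact lt_iSup_iff.1 ht
      · intro a ha b hb
        have h1 : ENNReal.ofReal t ^ 2 < h ((2⁻¹ : ℝ) • (a + b)) ^ 2 := by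
          rw [sq]
          exact (ENNReal.mul_lt_mul ha hb).trans_le (H a b)
        have h2 := lt_of_not_ge fun h3 => h1.not_ge (pow_le_pow_left' h3 2)
        simpa [div_eq_inv_mul] using h2
    · have e1 : {x | ENNReal.ofReal t < f x} = ∅ := by
        ext x
        simpa using ((le_iSup f x).trans hf1.le).trans (not_lt.1 ht)
      have e2 : {x | ENNReal.ofReal t < g x} = ∅ := by
        ext x
        simpa using ((le_iSup g x).trans hg1.le).trans (not_lt.1 ht)
      simp [e1, e2]
  · refine (Antitone.measurable fun s t hst => measure_mono fun x hx => ?_).aemeasurable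
    exact (ENNReal.ofReal_le_ofReal hst).trans_lt hx

theorem lintegral_mul_lintegral_le_of_iSup_ne_top {f g h : ℝ → ENNReal} (hf : Measurable f)
    (hg : Measurable g) (hh : Measurable h) (hf1 : ⨆ x, f x ≠ ⊤) (hg1 : ⨆ x, g x ≠ ⊤)
    (H : ∀ x y, f x * g y ≤ h ((2⁻¹ : ℝ) • (x + y)) ^ 2) :
    (∫⁻ x, f x) * (∫⁻ x, g x) ≤ (∫⁻ x, h x) ^ 2 := by
  rcases eq_or_ne (⨆ x, f x) 0 with hf0 | hf0
  · simp only [ENNReal.iSup_eq_zero] at hf0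
    simp [hf0]
  rcases eq_or_ne (⨆ x, g x) 0 with hg0 | hg0
  · simp only [ENNReal.iSup_eq_zero] at hg0
    simp [hg0]
  set a := ⨆ x, f x with ha
  set b := ⨆ x, g x with hb
  -- Dividing `h` by the geometric mean of the suprema preserves the hypothesis; AM–GM then turns
  -- the sum into a product.
  obtain ⟨c, hc⟩ : ∃ c : ENNReal, c ^ 2 = a * b := by
    refine ⟨(a * b) ^ (1 / 2 : ℝ), ?_⟩
    rw [← ENNReal.rpow_natCast, ← ENNReal.rpow_mul]
    norm_num
  have hab0 : a * b ≠ 0 := mul_ne_zero hf0 hg0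
  have habt : a * b ≠ ⊤ := ENNReal.mul_ne_top hf1 hg1
  have key := lintegral_add_lintegral_le_of_iSup_eq_one (f := fun x => a⁻¹ * f x)
    (g := fun x => b⁻¹ * g x) (h := fun x => c⁻¹ * h x) (by fun_prop) (by fun_prop) (by fun_prop)
    (by rw [← ENNReal.mul_iSup, ← ha, ENNReal.inv_mul_cancel hf0 hf1])
    (by rw [← ENNReal.mul_iSup, ← hb, ENNReal.inv_mul_cancel hg0 hg1]) (by
      intro x y
      calc a⁻¹ * f x * (b⁻¹ * g y) = (a * b)⁻¹ * (f x * g y) := by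
            rw [ENNReal.mul_inv (Or.inl hf0) (Or.inl hf1)]; ring
        _ ≤ (a * b)⁻¹ * h ((2⁻¹ : ℝ) • (x + y)) ^ 2 := by gcongr; exact H x y
        _ = _ := by rw [← hc, mul_pow, ENNReal.inv_pow])
  have key2 := ENNReal.mul_le_sq_of_add_le_two_mul key
  rw [lintegral_const_mul _ hf, lintegral_const_mul _ hg, lintegral_const_mul _ hh, mul_pow,
    ← ENNReal.inv_pow, hc] at key2
  have key3 : (a * b) * ((a * b)⁻¹ * ((∫⁻ x, f x) * (∫⁻ x, g x))) ≤
      (a * b) * ((a * b)⁻¹ * (∫⁻ x, h x) ^ 2) := by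
    refine mul_le_mul_right ?_ _
    convert key2 using 1
    rw [ENNReal.mul_inv (Or.inl hf0) (Or.inl hf1)]
    ring
  rwa [← mul_assoc, ← mul_assoc (a * b) _ ((∫⁻ x, h x) ^ 2), ENNReal.mul_inv_cancel hab0 habt, one_mul, one_mul] at key3

theorem iSup_lintegral_min_natCast {α : Type*} [MeasurableSpace α] (μ : Measure α)
    {f : α → ENNReal} (hf : Measurable f) :
    ⨆ n : ℕ, ∫⁻ x, min (f x) n ∂μ = ∫⁻ x, f x ∂μ := by
  rw [← lintegral_iSup (fun n => by fun_prop)]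
  · refine lintegral_congr fun x => ?_
    have : ⨆ n : ℕ, min (f x) (n : ENNReal) = min (f x) (⨆ n : ℕ, (n : ENNReal)) :=
      (inf_iSup_eq _ _).symm
    rw [this, ENNReal.iSup_natCast, min_eq_left le_top]
  · intro m n hmn x
    have : (m : ENNReal) ≤ n := by exact_mod_cast hmn
    exact min_le_min le_rfl this

/-- Truncating `f` and `g` preserves the hypothesis and makes the suprema finite; monotone
convergence removes the truncation. -/
theorem satisfiesMidpointPrekopaLeindler_real :
    SatisfiesMidpointPrekopaLeindler (volume : Measure ℝ) := by
  intro f g h hf hg hh H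
  rw [← iSup_lintegral_min_natCast _ hf, ← iSup_lintegral_min_natCast _ hg, ENNReal.iSup_mul]
  refine iSup_le fun m => ?_
  rw [ENNReal.mul_iSup]
  refine iSup_le fun n => ?_
  refine lintegral_mul_lintegral_le_of_iSup_ne_top (by fun_prop) (by fun_prop) hh ?_ ?_ ?_
  · exact ne_top_of_le_ne_top (ENNReal.natCast_ne_top m) (iSup_le fun x => min_le_right _ _)
  · exact ne_top_of_le_ne_top (ENNReal.natCast_ne_top n) (iSup_le fun x => min_le_right _ _)
  · exact fun x y => (mul_le_mul' (min_le_left _ _) (min_le_left _ _)).trans (H x y)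

/-- The inequality on the fibres is exactly the hypothesis needed for the fibre integrals on the
base. -/
theorem SatisfiesMidpointPrekopaLeindler.prod {E F : Type*} [AddCommGroup E] [Module ℝ E]
    [MeasurableSpace E] [AddCommGroup F] [Module ℝ F] [MeasurableSpace F] {μ : Measure E}
    {ν : Measure F} [SFinite ν] (hμ : SatisfiesMidpointPrekopaLeindler μ)
    (hν : SatisfiesMidpointPrekopaLeindler ν) :
    SatisfiesMidpointPrekopaLeindler (μ.prod ν) := by
  intro f g h hf hg hh H
  rw [lintegral_prod _ hf.aemeasurable, lintegral_prod _ hg.aemeasurable,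
    lintegral_prod _ hh.aemeasurable]
  refine hμ _ _ _ hf.lintegral_prod_right' hg.lintegral_prod_right' hh.lintegral_prod_right' ?_
  intro x y
  refine hν _ _ _ (by fun_prop) (by fun_prop) (by fun_prop) ?_
  intro u v
  exact H (x, u) (y, v)

theorem SatisfiesMidpointPrekopaLeindler.of_measurePreserving {E F : Type*} [AddCommGroup E]
    [Module ℝ E] [MeasurableSpace E] [AddCommGroup F] [Module ℝ F] [MeasurableSpace F]
    {μ : Measure E} {ν : Measure F} (hν : SatisfiesMidpointPrekopaLeindler ν) {φ : F → E}
    (hφ : MeasurePreserving φ ν μ)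
    (hmid : ∀ x y, φ ((2⁻¹ : ℝ) • (x + y)) = (2⁻¹ : ℝ) • (φ x + φ y)) :
    SatisfiesMidpointPrekopaLeindler μ := by
  intro f g h hf hg hh H
  rw [← hφ.lintegral_comp hf, ← hφ.lintegral_comp hg, ← hφ.lintegral_comp hh]
  have := hφ.measurable
  refine hν _ _ _ (by fun_prop) (by fun_prop) (by fun_prop) fun x y => ?_
  rw [hmid]
  exact H _ _

theorem satisfiesMidpointPrekopaLeindler_pi (n : ℕ) :
    SatisfiesMidpointPrekopaLeindler (volume : Measure (Fin n → ℝ)) := by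
  induction n with
  | zero =>
    intro f g h hf hg hh H
    simp only [lintegral_unique, volume_pi, Measure.pi_empty_univ, mul_one]
    convert H default default
  | succ n ih =>
    refine (satisfiesMidpointPrekopaLeindler_real.prod ih).of_measurePreserving
      ((volume_preserving_piFinSuccAbove (fun _ : Fin (n + 1) => ℝ) 0).symm _) fun x y => ?_
    ext i
    refine Fin.cases ?_ (fun j => ?_) i <;> simp [MeasurableEquiv.piFinSuccAbove, mul_add]

theorem satisfiesMidpointPrekopaLeindler_euclideanSpace (n : ℕ) :
    SatisfiesMidpointPrekopaLeindler (volume : Measure (EuclideanSpace ℝ (Fin n))) :=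
  (satisfiesMidpointPrekopaLeindler_pi n).of_measurePreserving (PiLp.volume_preserving_toLp (Fin n))
    fun _ _ => rfl

/-- Multiplicative Brunn–Minkowski inequality for midpoints. -/
theorem volume_mul_volume_le_sq {n : ℕ} {A B C : Set (EuclideanSpace ℝ (Fin n))}
    (hA : MeasurableSet A) (hB : MeasurableSet B) (hC : MeasurableSet C)
    (h : ∀ a ∈ A, ∀ b ∈ B, (2⁻¹ : ℝ) • (a + b) ∈ C) :
    volume A * volume B ≤ volume C ^ 2 := by
  have := satisfiesMidpointPrekopaLeindler_euclideanSpace n (A.indicator 1) (B.indicator 1)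
    (C.indicator 1) (measurable_one.indicator hA) (measurable_one.indicator hB)
    (measurable_one.indicator hC) fun x y => ?_
  · simpa [lintegral_indicator_one, hA, hB, hC] using this
  · by_cases hx : x ∈ A
    · by_cases hy : y ∈ B
      · rw [Set.indicator_of_mem (h x hx y hy), Set.indicator_of_mem hx, Set.indicator_of_mem hy]
        simp
      · simp [hy]
    · simp [hx]

/-! ### Slabs and the floating width -/

theorem volume_setOf_inner_eq {n : ℕ} {θ : EuclideanSpace ℝ (Fin n)} (hθ : θ ≠ 0) (c : ℝ) :
    volume {x : EuclideanSpace ℝ (Fin n) | inner ℝ x θ = c} = 0 := by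
  rcases Set.eq_empty_or_nonempty {x : EuclideanSpace ℝ (Fin n) | inner ℝ x θ = c} with h | ⟨x₀, hx₀⟩
  · rw [h, measure_empty]
  · have h1 : volume ((ℝ ∙ θ)ᗮ : Set (EuclideanSpace ℝ (Fin n))) = 0 := by
      refine Measure.addHaar_submodule _ _ fun h => hθ ?_
      have : θ ∈ (ℝ ∙ θ)ᗮ := h ▸ Submodule.mem_top
      exact inner_self_eq_zero.1 (Submodule.mem_orthogonal_singleton_iff_inner_left.1 this)
    rw [← measure_preimage_add_right volume (-x₀)] at h1
    refine measure_mono_null (fun x hx => ?_) h1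
    simp only [Set.mem_preimage, SetLike.mem_coe, Submodule.mem_orthogonal_singleton_iff_inner_left,
      inner_add_left, inner_neg_left]
    have e1 : inner ℝ x θ = c := hx
    have e2 : inner ℝ x₀ θ = c := hx₀
    linarith

theorem volume_setOf_abs_inner_eq {n : ℕ} {θ : EuclideanSpace ℝ (Fin n)} (hθ : θ ≠ 0) (c : ℝ) :
    volume {x : EuclideanSpace ℝ (Fin n) | |inner ℝ x θ| = c} = 0 := by
  refine measure_mono_null (fun x hx => ?_)
    (measure_union_null (volume_setOf_inner_eq hθ c) (volume_setOf_inner_eq hθ (-c)))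
  have hx' : |inner ℝ x θ| = c := hx
  rcases abs_choice (inner ℝ x θ) with h | h
  · exact Or.inl (h.symm.trans hx')
  · refine Or.inr ?_
    show inner ℝ x θ = -c
    linarith

theorem measurableSet_inter_abs_inner_le {n : ℕ} {K : Set (EuclideanSpace ℝ (Fin n))}
    (hK : IsCompact K) (θ : EuclideanSpace ℝ (Fin n)) (t : ℝ) :
    MeasurableSet {x | x ∈ K ∧ |inner ℝ x θ| ≤ t} :=
  hK.measurableSet.inter (measurableSet_le
    (f := fun x : EuclideanSpace ℝ (Fin n) => |inner ℝ x θ|) (by fun_prop) measurable_const)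

/-- Indicators of the slabs converge off the null set `|⟨x, θ⟩| = t₀`, and `K` has finite volume. -/
theorem continuous_volume_slab {n : ℕ} {K : Set (EuclideanSpace ℝ (Fin n))} (hK : IsCompact K)
    {θ : EuclideanSpace ℝ (Fin n)} (hθ : θ ≠ 0) :
    Continuous fun t : ℝ => volume {x | x ∈ K ∧ |inner ℝ x θ| ≤ t} := by
  refine continuous_iff_continuousAt.2 fun t₀ => ?_
  refine tendsto_measure_of_ae_tendsto_indicator (B := K) _
    (measurableSet_inter_abs_inner_le hK θ t₀) (fun t => measurableSet_inter_abs_inner_le hK θ t)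
    hK.measurableSet hK.measure_lt_top.ne
    (Filter.Eventually.of_forall fun t x hx => hx.1) ?_
  have h0 : ∀ᵐ x : EuclideanSpace ℝ (Fin n), |inner ℝ x θ| ≠ t₀ :=
    measure_eq_zero_iff_ae_notMem.1 (volume_setOf_abs_inner_eq hθ t₀)
  filter_upwards [h0] with x hx
  rcases lt_or_gt_of_ne hx with h | h
  · filter_upwards [lt_mem_nhds h] with t ht
    simp [ht.le, h.le]
  · filter_upwards [gt_mem_nhds h] with t ht
    simp [not_le.2 ht, not_le.2 h]

theorem exists_forall_abs_inner_le {n : ℕ} {K : Set (EuclideanSpace ℝ (Fin n))} (hK : IsCompact K)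
    (θ : EuclideanSpace ℝ (Fin n)) : ∃ R : ℝ, 0 < R ∧ ∀ x ∈ K, |inner ℝ x θ| ≤ R := by
  obtain ⟨R, hR⟩ := hK.exists_bound_of_continuousOn
    (f := fun x : EuclideanSpace ℝ (Fin n) => (inner ℝ x θ : ℝ)) (by fun_prop)
  exact ⟨max R 1, by positivity, fun x hx => (hR x hx).trans (le_max_left _ _)⟩

/-- The supremum defining the width of the floating body is attained. -/
theorem floatingWidth_mem {n : ℕ} {K : Set (EuclideanSpace ℝ (Fin n))} (hK : IsCompact K)
    (hvol : volume K = 1) {θ : EuclideanSpace ℝ (Fin n)} (hθ : θ ≠ 0) {δ : ℝ} (hδ : 0 < δ)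
    (hδ1 : δ < 1) :
    0 < floatingWidth K δ θ ∧
      volume {x | x ∈ K ∧ |inner ℝ x θ| ≤ floatingWidth K δ θ} = ENNReal.ofReal (1 - δ) := by
  have hcont := continuous_volume_slab hK hθ
  obtain ⟨R, hR, hRK⟩ := exists_forall_abs_inner_le hK θ
  have hbig : ∀ t, R ≤ t → volume {x | x ∈ K ∧ |inner ℝ x θ| ≤ t} = 1 := by
    intro t ht
    rw [← hvol]
    congr 1
    ext x
    exact ⟨fun h => h.1, fun h => ⟨h, (hRK x h).trans ht⟩⟩
  have h0 : volume {x | x ∈ K ∧ |inner ℝ x θ| ≤ 0} = 0 := by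
    refine measure_mono_null (fun x hx => ?_) (volume_setOf_inner_eq hθ 0)
    exact abs_nonpos_iff.1 hx.2
  have hlt : ENNReal.ofReal (1 - δ) < 1 := ENNReal.ofReal_lt_one.2 (by linarith)
  have hpos : 0 < ENNReal.ofReal (1 - δ) := ENNReal.ofReal_pos.2 (by linarith)
  set S : Set ℝ := {t : ℝ | 0 < t ∧ volume {x | x ∈ K ∧ |inner ℝ x θ| ≤ t} = ENNReal.ofReal (1 - δ)}
    with hS
  have hbdd : BddAbove S := by
    refine ⟨R, fun t ht => ?_⟩
    by_contra hlt'
    exact hlt.ne (ht.2.symm.trans (hbig t (not_le.1 hlt').le))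
  obtain ⟨t, ht⟩ : S.Nonempty := by
    obtain ⟨t, ht, hte⟩ := intermediate_value_Icc hR.le hcont.continuousOn
      (show ENNReal.ofReal (1 - δ) ∈ Set.Icc _ _ from
        ⟨h0.trans_le hpos.le, hlt.le.trans (hbig R le_rfl).ge⟩)
    refine ⟨t, ht.1.lt_of_ne ?_, hte⟩
    rintro rfl
    exact hpos.ne (h0.symm.trans hte)
  refine ⟨ht.1.trans_le (le_csSup hbdd ht), ?_⟩
  -- Closedness is used without the condition `0 < t`, whose limit case was settled by `le_csSup`.
  have hcl : IsClosed {t : ℝ | volume {x | x ∈ K ∧ |inner ℝ x θ| ≤ t} = ENNReal.ofReal (1 - δ)} :=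
    isClosed_eq hcont continuous_const
  exact closure_minimal (fun t ht => ht.2) hcl (csSup_mem_closure ⟨t, ht⟩ hbdd)

/-! ### Caps and their decay -/

/-- The part of `K` on the side `t ≤ ⟨x, θ⟩` of a hyperplane. -/
def convexCap {n : ℕ} (K : Set (EuclideanSpace ℝ (Fin n))) (θ : EuclideanSpace ℝ (Fin n)) (t : ℝ) :
    Set (EuclideanSpace ℝ (Fin n)) :=
  {x | x ∈ K ∧ t ≤ inner ℝ x θ}

theorem measurableSet_convexCap {n : ℕ} {K : Set (EuclideanSpace ℝ (Fin n))} (hK : IsCompact K)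
    (θ : EuclideanSpace ℝ (Fin n)) (t : ℝ) : MeasurableSet (convexCap K θ t) :=
  hK.measurableSet.inter (measurableSet_le measurable_const
    (g := fun x : EuclideanSpace ℝ (Fin n) => (inner ℝ x θ : ℝ)) (by fun_prop))

theorem neg_preimage_convexCap {n : ℕ} {K : Set (EuclideanSpace ℝ (Fin n))}
    (hsymm : ∀ x ∈ K, -x ∈ K) (θ : EuclideanSpace ℝ (Fin n)) (t : ℝ) :
    Neg.neg ⁻¹' convexCap K θ t = {x | x ∈ K ∧ inner ℝ x θ ≤ -t} := by
  ext x
  have : -x ∈ K ↔ x ∈ K := ⟨fun h => neg_neg x ▸ hsymm _ h, hsymm x⟩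
  simp only [convexCap, Set.mem_preimage, Set.mem_ofPred_eq, this, inner_neg_left, le_neg]

theorem volume_setOf_inner_le_neg {n : ℕ} {K : Set (EuclideanSpace ℝ (Fin n))}
    (hsymm : ∀ x ∈ K, -x ∈ K) (θ : EuclideanSpace ℝ (Fin n)) (t : ℝ) :
    volume {x | x ∈ K ∧ inner ℝ x θ ≤ -t} = volume (convexCap K θ t) := by
  rw [← neg_preimage_convexCap hsymm, Measure.measure_preimage_neg]

theorem one_le_two_mul_volume_convexCap_zero {n : ℕ} {K : Set (EuclideanSpace ℝ (Fin n))}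
    (hsymm : ∀ x ∈ K, -x ∈ K) (hvol : volume K = 1) (θ : EuclideanSpace ℝ (Fin n)) :
    1 ≤ 2 * volume (convexCap K θ 0) := by
  have h := volume_setOf_inner_le_neg hsymm θ 0
  rw [two_mul, ← hvol]
  nth_rw 2 [← h]
  refine (measure_mono fun x hx => ?_).trans (measure_union_le _ _)
  rcases le_total 0 (inner ℝ x θ : ℝ) with h | h
  · exact Or.inl ⟨hx, h⟩
  · exact Or.inr ⟨hx, by simpa using h⟩

/-- The cap at the width of the floating body has volume `δ / 2`. -/
theorem two_mul_volume_convexCap_floatingWidth {n : ℕ} {K : Set (EuclideanSpace ℝ (Fin n))}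
    (hK : IsCompact K) (hsymm : ∀ x ∈ K, -x ∈ K) (hvol : volume K = 1)
    {θ : EuclideanSpace ℝ (Fin n)} (hθ : θ ≠ 0) {δ : ℝ} (hδ : 0 < δ) (hδ1 : δ < 1) :
    2 * volume (convexCap K θ (floatingWidth K δ θ)) = ENNReal.ofReal δ := by
  obtain ⟨hT, hTv⟩ := floatingWidth_mem hK hvol hθ hδ hδ1
  set T := floatingWidth K δ θ
  have hm : MeasurableSet {x | x ∈ K ∧ inner ℝ x θ ≤ -T} :=
    hK.measurableSet.inter (measurableSet_le
      (f := fun x : EuclideanSpace ℝ (Fin n) => (inner ℝ x θ : ℝ)) (by fun_prop) measurable_const)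
  have h2 : volume (convexCap K θ T ∪ {x | x ∈ K ∧ inner ℝ x θ ≤ -T}) =
      2 * volume (convexCap K θ T) := by
    rw [measure_union _ hm, volume_setOf_inner_le_neg hsymm, two_mul]
    refine Set.disjoint_left.2 fun x hx hx' => ?_
    have h1 := hx.2
    have h2 := hx'.2
    linarith
  have h3 := measure_union_add_inter (μ := volume) {x | x ∈ K ∧ |inner ℝ x θ| ≤ T}
    ((measurableSet_convexCap hK θ T).union hm)
  have h4 : {x | x ∈ K ∧ |inner ℝ x θ| ≤ T} ∪
      (convexCap K θ T ∪ {x | x ∈ K ∧ inner ℝ x θ ≤ -T}) = K := by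
    refine Set.Subset.antisymm ?_ fun x hx => ?_
    · rintro x (h | h | h) <;> exact h.1
    · rcases le_total |inner ℝ x θ| T with h | h
      · exact Or.inl ⟨hx, h⟩
      · rcases le_abs.1 h with h | h
        · exact Or.inr (Or.inl ⟨hx, h⟩)
        · exact Or.inr (Or.inr ⟨hx, le_neg_of_le_neg h⟩)
  have h5 : volume ({x | x ∈ K ∧ |inner ℝ x θ| ≤ T} ∩
      (convexCap K θ T ∪ {x | x ∈ K ∧ inner ℝ x θ ≤ -T})) = 0 := by
    refine measure_mono_null (fun x hx => ?_) (volume_setOf_abs_inner_eq hθ T)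
    refine le_antisymm hx.1.2 ?_
    rcases hx.2 with h | h
    · exact h.2.trans (le_abs_self _)
    · exact (le_neg_of_le_neg h.2).trans (neg_le_abs _)
  rw [h4, h5, hvol, hTv, h2, add_zero] at h3
  have h6 : (1 : ENNReal) = ENNReal.ofReal (1 - δ) + ENNReal.ofReal δ := by
    rw [← ENNReal.ofReal_add (by linarith) hδ.le]
    simp
  rw [h6] at h3
  exact ((ENNReal.add_right_inj ENNReal.ofReal_ne_top).1 h3).symm

/-- Log-concavity of the volumes of the caps of a convex set. -/
theorem volume_convexCap_mul_le_sq {n : ℕ} {K : Set (EuclideanSpace ℝ (Fin n))} (hK : IsCompact K)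
    (hconv : Convex ℝ K) (θ : EuclideanSpace ℝ (Fin n)) {a b c : ℝ} (h : 2 * c ≤ a + b) :
    volume (convexCap K θ a) * volume (convexCap K θ b) ≤ volume (convexCap K θ c) ^ 2 := by
  refine volume_mul_volume_le_sq (measurableSet_convexCap hK θ a) (measurableSet_convexCap hK θ b)
    (measurableSet_convexCap hK θ c) ?_
  rintro x ⟨hx, hxa⟩ y ⟨hy, hyb⟩
  refine ⟨?_, ?_⟩
  · rw [smul_add]
    exact hconv hx hy (by norm_num) (by norm_num) (by norm_num)
  · rw [real_inner_smul_left, inner_add_left]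
    linarith

/-- Log-concavity makes ratios of successive cap volumes nonincreasing, so the first ratio controls
all of them. -/
theorem volume_convexCap_succ_mul_le {n : ℕ} {K : Set (EuclideanSpace ℝ (Fin n))} (hK : IsCompact K)
    (hconv : Convex ℝ K) (θ : EuclideanSpace ℝ (Fin n)) {t : ℝ} (ht : 0 ≤ t) {q : ENNReal}
    (h : volume (convexCap K θ t) ≤ q * volume (convexCap K θ 0)) (k : ℕ) :
    volume (convexCap K θ ((k + 1 : ℕ) * t)) ≤ q * volume (convexCap K θ (k * t)) := by
  induction k with
  | zero => simpa using h
  | succ k ih =>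
    have hfin : ∀ s, volume (convexCap K θ s) ≠ ⊤ := fun s =>
      ((measure_mono fun x hx => hx.1).trans_lt hK.measure_lt_top).ne
    have hlc := volume_convexCap_mul_le_sq hK hconv θ (a := k * t) (b := (k + 1 + 1 : ℕ) * t)
      (c := (k + 1 : ℕ) * t) (by push_cast; linarith)
    rcases eq_or_ne (volume (convexCap K θ (k * t))) 0 with h0 | h0
    · have : volume (convexCap K θ ((k + 1 + 1 : ℕ) * t)) = 0 := by
        refine measure_mono_null (t := convexCap K θ (k * t))
          (fun x hx => ⟨hx.1, le_trans ?_ hx.2⟩) h0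
        push_cast
        nlinarith
      rw [this]
      exact zero_le
    · refine (ENNReal.mul_le_mul_iff_right h0 (hfin _)).1 (hlc.trans ?_)
      rw [sq]
      calc _ ≤ (q * volume (convexCap K θ (k * t))) * volume (convexCap K θ ((k + 1 : ℕ) * t)) := by
            gcongr
        _ = _ := by ring

/-- Exponential decay of the volumes of the caps. -/
theorem volume_convexCap_nat_mul_le {n : ℕ} {K : Set (EuclideanSpace ℝ (Fin n))} (hK : IsCompact K)
    (hconv : Convex ℝ K) (hvol : volume K = 1) (θ : EuclideanSpace ℝ (Fin n)) {t : ℝ} (ht : 0 ≤ t)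
    {q : ENNReal} (h : volume (convexCap K θ t) ≤ q * volume (convexCap K θ 0)) (k : ℕ) :
    volume (convexCap K θ (k * t)) ≤ q ^ k := by
  induction k with
  | zero =>
    rw [pow_zero, ← hvol]
    exact measure_mono fun x hx => hx.1
  | succ k ih =>
    refine (volume_convexCap_succ_mul_le hK hconv θ ht h k).trans ?_
    rw [pow_succ']
    gcongr

/-! ### Bounds on the Laplace transform -/

theorem integrableOn_exp_inner {n : ℕ} {K : Set (EuclideanSpace ℝ (Fin n))} (hK : IsCompact K)
    (u : EuclideanSpace ℝ (Fin n)) :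
    IntegrableOn (fun y : EuclideanSpace ℝ (Fin n) => Real.exp (inner ℝ y u)) K :=
  ContinuousOn.integrableOn_compact hK (by fun_prop)

/-- Symmetry equates the integrals at `u` and `-u`, and `e^a + e^(-a) ≥ 2`. -/
theorem one_le_setIntegral_exp_inner {n : ℕ} {K : Set (EuclideanSpace ℝ (Fin n))} (hK : IsCompact K)
    (hsymm : ∀ x ∈ K, -x ∈ K) (hvol : volume K = 1) (u : EuclideanSpace ℝ (Fin n)) :
    1 ≤ ∫ y in K, Real.exp (inner ℝ y u) := by
  have hpre : Neg.neg ⁻¹' K = K := by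
    ext x
    exact ⟨fun h => neg_neg x ▸ hsymm _ h, hsymm x⟩
  have h1 : ∫ y in K, Real.exp (inner ℝ y (-u)) = ∫ y in K, Real.exp (inner ℝ y u) := by
    have := (Measure.measurePreserving_neg (volume : Measure (EuclideanSpace ℝ (Fin n)))).setIntegral_preimage_emb
      (MeasurableEquiv.neg _).measurableEmbedding (fun y => Real.exp (inner ℝ y u)) K
    rw [hpre] at this
    simpa using this
  have h2 : ∫ y in K, (2 : ℝ) ≤
      ∫ y in K, (Real.exp (inner ℝ y u) + Real.exp (inner ℝ y (-u))) := by
    refine integral_mono (continuousOn_const.integrableOn_compact hK)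
      ((integrableOn_exp_inner hK u).add (integrableOn_exp_inner hK (-u))) fun y => ?_
    show (2 : ℝ) ≤ Real.exp (inner ℝ y u) + Real.exp (inner ℝ y (-u))
    rw [inner_neg_right]
    have h3 := Real.add_one_le_exp (inner ℝ y u : ℝ)
    have h4 := Real.add_one_le_exp (-inner ℝ y u : ℝ)
    linarith
  rw [integral_add (integrableOn_exp_inner hK u) (integrableOn_exp_inner hK (-u)), h1] at h2
  simp [hvol, Measure.real] at h2
  linarith

theorem logLaplace_nonneg {n : ℕ} {K : Set (EuclideanSpace ℝ (Fin n))} (hK : IsCompact K)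
    (hsymm : ∀ x ∈ K, -x ∈ K) (hvol : volume K = 1) (u : EuclideanSpace ℝ (Fin n)) :
    0 ≤ logLaplace K u :=
  Real.log_nonneg (one_le_setIntegral_exp_inner hK hsymm hvol u)

/-- Laplace transform bound for a body whose caps decay geometrically. -/
theorem setLIntegral_exp_inner_le {n : ℕ} {K : Set (EuclideanSpace ℝ (Fin n))} (hK : IsCompact K)
    (hconv : Convex ℝ K) (hvol : volume K = 1) (θ : EuclideanSpace ℝ (Fin n)) {t r : ℝ}
    (ht : 0 < t) (hr : 0 < r)
    (h : volume (convexCap K θ t) ≤ ENNReal.ofReal (Real.exp (-r)) * volume (convexCap K θ 0)) :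
    ∫⁻ y in K, ENNReal.ofReal (Real.exp (inner ℝ y ((r / (2 * t)) • θ))) ≤
      ENNReal.ofReal (1 + Real.exp (r / 2) * (1 - Real.exp (-(r / 2)))⁻¹) := by
  have hq0 : 0 ≤ Real.exp (-(r / 2)) := (Real.exp_pos _).le
  have hq1 : Real.exp (-(r / 2)) < 1 := Real.exp_lt_one_iff.2 (by linarith)
  -- `c k` bounds the integrand where `kt ≤ ⟨y, θ⟩ ≤ (k+1)t`. The growth rate `r/(2t)` is half the
  -- decay rate of the caps, leaving a geometric series of ratio `e^(-r/2)`.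
  let c : ℕ → ENNReal := fun k => ENNReal.ofReal (Real.exp (r / 2 * (k + 1)))
  have hpt : ∀ y ∈ K, ENNReal.ofReal (Real.exp (inner ℝ y ((r / (2 * t)) • θ))) ≤
      1 + ∑' k : ℕ, (convexCap K θ (k * t)).indicator (fun _ => c k) y := by
    intro y hy
    rw [real_inner_smul_right]
    rcases le_total (inner ℝ y θ : ℝ) 0 with h0 | h0
    · refine le_add_right (ENNReal.ofReal_le_one.2 (Real.exp_le_one_iff.2 ?_))
      exact mul_nonpos_of_nonneg_of_nonpos (by positivity) h0
    · refine le_add_left (le_trans ?_ (ENNReal.le_tsum ⌊inner ℝ y θ / t⌋₊))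
      have hfl : (⌊inner ℝ y θ / t⌋₊ : ℝ) * t ≤ inner ℝ y θ :=
        (le_div_iff₀ ht).1 (Nat.floor_le (by positivity))
      rw [Set.indicator_of_mem (show y ∈ convexCap K θ _ from ⟨hy, hfl⟩)]
      refine ENNReal.ofReal_le_ofReal (Real.exp_le_exp.2 ?_)
      have h2 := (Nat.lt_floor_add_one (inner ℝ y θ / t)).le
      calc r / (2 * t) * inner ℝ y θ = r / 2 * (inner ℝ y θ / t) := by field_simp
        _ ≤ _ := by gcongr
  have hterm : ∀ k : ℕ, ∫⁻ y in K, (convexCap K θ (k * t)).indicator (fun _ => c k) y ≤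
      ENNReal.ofReal (Real.exp (r / 2) * Real.exp (-(r / 2)) ^ k) := by
    intro k
    calc ∫⁻ y in K, (convexCap K θ (k * t)).indicator (fun _ => c k) y
        ≤ ∫⁻ y, (convexCap K θ (k * t)).indicator (fun _ => c k) y :=
          lintegral_mono' Measure.restrict_le_self le_rfl
      _ = c k * volume (convexCap K θ (k * t)) :=
          lintegral_indicator_const (measurableSet_convexCap hK θ _) _
      _ ≤ c k * ENNReal.ofReal (Real.exp (-r)) ^ k := by
          gcongr
          exact volume_convexCap_nat_mul_le hK hconv hvol θ ht.le h k
      _ = _ := by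
          rw [← ENNReal.ofReal_pow (Real.exp_pos _).le, ← ENNReal.ofReal_mul (Real.exp_pos _).le,
            ← Real.exp_nat_mul, ← Real.exp_nat_mul, ← Real.exp_add, ← Real.exp_add]
          congr 2
          ring
  calc ∫⁻ y in K, ENNReal.ofReal (Real.exp (inner ℝ y ((r / (2 * t)) • θ)))
      ≤ ∫⁻ y in K, (1 + ∑' k : ℕ, (convexCap K θ (k * t)).indicator (fun _ => c k) y) :=
        setLIntegral_mono' hK.measurableSet hpt
    _ = 1 + ∑' k : ℕ, ∫⁻ y in K, (convexCap K θ (k * t)).indicator (fun _ => c k) y := by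
        rw [lintegral_add_left measurable_const, lintegral_tsum fun k =>
          (measurable_const.indicator (measurableSet_convexCap hK θ _)).aemeasurable]
        simp [hvol]
    _ ≤ 1 + ∑' k : ℕ, ENNReal.ofReal (Real.exp (r / 2) * Real.exp (-(r / 2)) ^ k) := by
        gcongr with k
        exact hterm k
    _ = _ := by
        rw [← ENNReal.ofReal_tsum_of_nonneg (fun k => by positivity)
          ((summable_geometric_of_lt_one hq0 hq1).mul_left _), tsum_mul_left,
          tsum_geometric_of_lt_one hq0 hq1, ENNReal.ofReal_add zero_le_one
          (mul_nonneg (Real.exp_pos _).le (inv_nonneg.2 (by linarith))), ENNReal.ofReal_one]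

theorem logLaplace_le {n : ℕ} {K : Set (EuclideanSpace ℝ (Fin n))} (hK : IsCompact K)
    (hconv : Convex ℝ K) (hsymm : ∀ x ∈ K, -x ∈ K) (hvol : volume K = 1)
    (θ : EuclideanSpace ℝ (Fin n)) {t r : ℝ} (ht : 0 < t) (hr : Real.log 2 ≤ r)
    (h : volume (convexCap K θ t) ≤ ENNReal.ofReal (Real.exp (-r)) * volume (convexCap K θ 0)) :
    logLaplace K ((r / (2 * t)) • θ) ≤ 7 / 2 * r := by
  have hr0 : 0 < r := (Real.log_pos one_lt_two).trans_le hr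
  have h1 := setLIntegral_exp_inner_le hK hconv hvol θ ht hr0 h
  rw [← ofReal_integral_eq_lintegral_ofReal (integrableOn_exp_inner hK _)
    (Filter.Eventually.of_forall fun y => (Real.exp_pos _).le)] at h1
  set q := Real.exp (-(r / 2)) with hq
  have hq0 : 0 < q := Real.exp_pos _
  have hq2 : q ^ 2 ≤ 1 / 2 := by
    rw [hq, ← Real.exp_nat_mul]
    calc Real.exp (((2 : ℕ) : ℝ) * -(r / 2)) = Real.exp (-r) := by congr 1; push_cast; ring
      _ ≤ Real.exp (-Real.log 2) := Real.exp_le_exp.2 (by linarith)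
      _ = 1 / 2 := by rw [Real.exp_neg, Real.exp_log two_pos]; norm_num
  have hq34 : q ≤ 3 / 4 := by nlinarith
  have hinv : (1 - q)⁻¹ ≤ 4 := by
    rw [inv_le_comm₀ (by linarith) (by norm_num)]
    linarith
  have he1 : 1 ≤ Real.exp (r / 2) := Real.one_le_exp (by linarith)
  -- The factor `8 = 2^3` costs `3 log 2 ≤ 3r` after taking logarithms, whence `7/2`.
  have h3 : 1 + Real.exp (r / 2) * (1 - q)⁻¹ ≤ 8 * Real.exp (r / 2) := by nlinarith
  have h2 := (ENNReal.ofReal_le_ofReal_iff (by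
    have : 0 ≤ (1 - q)⁻¹ := inv_nonneg.2 (by linarith)
    positivity)).1 h1
  calc logLaplace K ((r / (2 * t)) • θ) ≤ Real.log (8 * Real.exp (r / 2)) :=
        Real.log_le_log (zero_lt_one.trans_le (one_le_setIntegral_exp_inner hK hsymm hvol _))
          (h2.trans h3)
    _ = 3 * Real.log 2 + r / 2 := by
        rw [Real.log_mul (by norm_num) (Real.exp_pos _).ne', Real.log_exp,
          show (8 : ℝ) = 2 ^ 3 by norm_num, Real.log_pow]
        norm_num
    _ ≤ _ := by linarith

/-! ### Level set inside the floating body -/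

theorem inner_sub_logLaplace_le {n : ℕ} {K : Set (EuclideanSpace ℝ (Fin n))} {r : ℝ}
    {x : EuclideanSpace ℝ (Fin n)} (hx : x ∈ legendreLevelSet K r) (u : EuclideanSpace ℝ (Fin n)) :
    inner ℝ x u - logLaplace K u ≤ r := by
  have h1 : logLaplaceLegendre K x ≤ (r : EReal) := hx
  exact EReal.coe_le_coe_iff.1 ((le_iSup (fun u : EuclideanSpace ℝ (Fin n) =>
    ((inner ℝ x u - logLaplace K u : ℝ) : EReal)) u).trans h1)

theorem logLaplace_le_of_forall_le {n : ℕ} {K : Set (EuclideanSpace ℝ (Fin n))} (hK : IsCompact K)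
    (hsymm : ∀ x ∈ K, -x ∈ K) (hvol : volume K = 1) {u : EuclideanSpace ℝ (Fin n)} {a : ℝ}
    (h : ∀ y ∈ K, inner ℝ y u ≤ a) : logLaplace K u ≤ a := by
  rw [← Real.log_exp a]
  refine Real.log_le_log (zero_lt_one.trans_le (one_le_setIntegral_exp_inner hK hsymm hvol _)) ?_
  calc ∫ y in K, Real.exp (inner ℝ y u) ≤ ∫ y in K, Real.exp a :=
        setIntegral_mono_on (integrableOn_exp_inner hK u)
          (continuousOn_const.integrableOn_compact hK) hK.measurableSet
          fun y hy => Real.exp_le_exp.2 (h y hy)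
    _ = Real.exp a := by simp [hvol, Measure.real]

/-- The level sets of the Legendre transform lie inside the body. -/
theorem legendreLevelSet_subset {n : ℕ} {K : Set (EuclideanSpace ℝ (Fin n))} (hK : IsCompact K)
    (hconv : Convex ℝ K) (hsymm : ∀ x ∈ K, -x ∈ K) (hvol : volume K = 1) (r : ℝ) :
    legendreLevelSet K r ⊆ K := by
  intro x hx
  by_contra hxK
  obtain ⟨f, a, hfa, hax⟩ := geometric_hahn_banach_closed_point hconv hK.isClosed hxK
  let v := (InnerProductSpace.toDual ℝ (EuclideanSpace ℝ (Fin n))).symm f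
  have hv : ∀ y, inner ℝ y v = f y := fun y => by
    rw [real_inner_comm]
    exact InnerProductSpace.toDual_symm_apply
  -- Along the ray `s • v` normal to a separating hyperplane the Legendre functional grows linearly,
  -- contradicting the bound `r`.
  have hs : ∀ s : ℝ, 0 ≤ s → s * (f x - a) ≤ r := by
    intro s hs0
    have h1 := inner_sub_logLaplace_le hx (s • v)
    have h2 : logLaplace K (s • v) ≤ s * a := by
      refine logLaplace_le_of_forall_le hK hsymm hvol fun y hy => ?_
      rw [real_inner_smul_right, hv]
      exact mul_le_mul_of_nonneg_left (hfa y hy).le hs0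
    rw [real_inner_smul_right, hv] at h1
    linarith
  have hpos : 0 < f x - a := by linarith
  have h3 := hs ((|r| + 1) / (f x - a)) (by positivity)
  rw [div_mul_cancel₀ _ hpos.ne'] at h3
  linarith [le_abs_self r]

theorem floatingWidth_neg {n : ℕ} (K : Set (EuclideanSpace ℝ (Fin n))) (δ : ℝ)
    (θ : EuclideanSpace ℝ (Fin n)) : floatingWidth K δ (-θ) = floatingWidth K δ θ := by
  simp [floatingWidth]

/-- The constant comes from `r + 7r/2 = 9r/2` divided by `r/(2T)`. -/
theorem inner_le_nine_mul_floatingWidth {n : ℕ} {K : Set (EuclideanSpace ℝ (Fin n))}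
    (hK : IsCompact K) (hconv : Convex ℝ K) (hsymm : ∀ x ∈ K, -x ∈ K) (hvol : volume K = 1)
    {θ : EuclideanSpace ℝ (Fin n)} (hθ : θ ≠ 0) {δ : ℝ} (hδ : 0 < δ) (hδ2 : δ < 1 / 2)
    {x : EuclideanSpace ℝ (Fin n)} (hx : x ∈ legendreLevelSet K (Real.log (1 / δ))) :
    inner ℝ x θ ≤ 9 * floatingWidth K δ θ := by
  have hT := (floatingWidth_mem hK hvol hθ hδ (by linarith)).1
  have hcap := two_mul_volume_convexCap_floatingWidth hK hsymm hvol hθ hδ (by linarith)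
  have h0 := one_le_two_mul_volume_convexCap_zero hsymm hvol θ
  set T := floatingWidth K δ θ
  set r := Real.log (1 / δ) with hr
  have hexp : Real.exp (-r) = δ := by
    rw [hr, one_div, Real.log_inv, neg_neg, Real.exp_log hδ]
  have hr2 : Real.log 2 ≤ r :=
    Real.log_le_log two_pos (by rw [le_div_iff₀ hδ]; linarith)
  have hr0 : 0 < r := (Real.log_pos one_lt_two).trans_le hr2
  have hdecay : volume (convexCap K θ T) ≤
      ENNReal.ofReal (Real.exp (-r)) * volume (convexCap K θ 0) := by
    rw [hexp]
    refine (ENNReal.mul_le_mul_iff_right two_ne_zero ENNReal.ofNat_ne_top).1 ?_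
    calc 2 * volume (convexCap K θ T) = ENNReal.ofReal δ * 1 := by rw [hcap, mul_one]
      _ ≤ ENNReal.ofReal δ * (2 * volume (convexCap K θ 0)) := by gcongr
      _ = _ := by ring
  have h1 := inner_sub_logLaplace_le hx ((r / (2 * T)) • θ)
  have h2 := logLaplace_le hK hconv hsymm hvol θ hT hr2 hdecay
  rw [real_inner_smul_right] at h1
  have h3 : r / (2 * T) * inner ℝ x θ ≤ r / (2 * T) * (9 * T) := by
    have : r / (2 * T) * (9 * T) = 9 / 2 * r := by field_simp
    linarith
  exact le_of_mul_le_mul_left h3 (by positivity)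

theorem smul_legendreLevelSet_subset_floatingBody {n : ℕ} {K : Set (EuclideanSpace ℝ (Fin n))}
    (hK : IsCompact K) (hconv : Convex ℝ K) (hsymm : ∀ x ∈ K, -x ∈ K) (hvol : volume K = 1)
    {δ : ℝ} (hδ : 0 < δ) (hδ2 : δ < 1 / 2) :
    (1 / 9 : ℝ) • legendreLevelSet K (Real.log (1 / δ)) ⊆ floatingBody K δ := by
  rintro _ ⟨x, hx, rfl⟩
  refine Set.mem_iInter₂.2 fun θ hθ => ⟨?_, ?_⟩
  · have hxK := legendreLevelSet_subset hK hconv hsymm hvol _ hx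
    -- `x/9 = (5/9)x + (4/9)(-x)`.
    have := hconv hxK (hsymm x hxK) (show (0 : ℝ) ≤ 5 / 9 by norm_num)
      (show (0 : ℝ) ≤ 4 / 9 by norm_num) (by norm_num)
    rw [smul_neg, ← sub_eq_add_neg, ← sub_smul] at this
    norm_num at this ⊢
    exact this
  · have hθ0 : θ ≠ 0 := ne_zero_of_mem_unit_sphere ⟨θ, hθ⟩
    have h1 := inner_le_nine_mul_floatingWidth hK hconv hsymm hvol hθ0 hδ hδ2 hx
    have h2 := inner_le_nine_mul_floatingWidth hK hconv hsymm hvol (neg_ne_zero.2 hθ0) hδ hδ2 hx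
    rw [floatingWidth_neg, inner_neg_right] at h2
    show |inner ℝ ((1 / 9 : ℝ) • x) θ| ≤ _
    rw [real_inner_smul_left, abs_le]
    constructor <;> linarith

/-! ### Floating body inside the dilated level set -/

theorem mul_floatingWidth_sub_le_logLaplace {n : ℕ} {K : Set (EuclideanSpace ℝ (Fin n))}
    (hK : IsCompact K) (hsymm : ∀ x ∈ K, -x ∈ K) (hvol : volume K = 1)
    {θ : EuclideanSpace ℝ (Fin n)} (hθ : θ ≠ 0) {δ : ℝ} (hδ : 0 < δ) (hδ1 : δ < 1) {s : ℝ}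
    (hs : 0 ≤ s) :
    s * floatingWidth K δ θ + Real.log (δ / 2) ≤ logLaplace K (s • θ) := by
  have hcap := two_mul_volume_convexCap_floatingWidth hK hsymm hvol hθ hδ hδ1
  set T := floatingWidth K δ θ
  have hreal : volume.real (convexCap K θ T) = δ / 2 := by
    have := congrArg ENNReal.toReal hcap
    rw [ENNReal.toReal_mul, ENNReal.toReal_ofReal hδ.le] at this
    simp only [ENNReal.toReal_ofNat] at this
    rw [Measure.real]
    linarith
  have hsub : convexCap K θ T ⊆ K := fun x hx => hx.1
  have hint := (integrableOn_exp_inner hK (s • θ))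
  rw [← Real.log_exp (s * T), ← Real.log_mul (Real.exp_pos _).ne' (by positivity)]
  refine Real.log_le_log (by positivity) ?_
  calc Real.exp (s * T) * (δ / 2) = ∫ y in convexCap K θ T, Real.exp (s * T) := by
        rw [setIntegral_const, hreal, smul_eq_mul, mul_comm]
    _ ≤ ∫ y in convexCap K θ T, Real.exp (inner ℝ y (s • θ)) := by
        refine setIntegral_mono_on (integrableOn_const
          ((measure_mono hsub).trans_lt hK.measure_lt_top).ne)
          (hint.mono_set hsub) (measurableSet_convexCap hK θ T) fun y hy => ?_
        rw [real_inner_smul_right]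
        exact Real.exp_le_exp.2 (mul_le_mul_of_nonneg_left hy.2 hs)
    _ ≤ ∫ y in K, Real.exp (inner ℝ y (s • θ)) :=
        setIntegral_mono_set hint (Filter.Eventually.of_forall fun y => (Real.exp_pos _).le)
          hsub.eventuallyLE

theorem floatingBody_subset_smul_legendreLevelSet {n : ℕ} {K : Set (EuclideanSpace ℝ (Fin n))}
    (hK : IsCompact K) (hsymm : ∀ x ∈ K, -x ∈ K) (hvol : volume K = 1)
    {δ : ℝ} (hδ : 0 < δ) (hδ2 : δ < 1 / 2) :
    floatingBody K δ ⊆ (2 : ℝ) • legendreLevelSet K (Real.log (1 / δ)) := by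
  intro x hx
  refine ⟨(2⁻¹ : ℝ) • x, ?_, by simp⟩
  refine iSup_le fun u => EReal.coe_le_coe_iff.2 ?_
  have hΛ := logLaplace_nonneg hK hsymm hvol u
  have hr2 : Real.log 2 ≤ Real.log (1 / δ) :=
    Real.log_le_log two_pos (by rw [le_div_iff₀ hδ]; linarith)
  have hlog2 := Real.log_pos one_lt_two
  rcases eq_or_ne u 0 with rfl | hu
  · rw [inner_zero_right]
    linarith
  set s := ‖u‖ with hs
  have hs0 : 0 < s := norm_pos_iff.2 hu
  set θ := s⁻¹ • u with hθ
  have hθ1 : ‖θ‖ = 1 := by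
    rw [hθ, norm_smul, hs, norm_inv, norm_norm, inv_mul_cancel₀ hs0.ne']
  have hθ0 : θ ≠ 0 := norm_ne_zero_iff.1 (by rw [hθ1]; exact one_ne_zero)
  have hus : u = s • θ := by rw [hθ, smul_inv_smul₀ hs0.ne']
  have hxθ : |inner ℝ x θ| ≤ floatingWidth K δ θ :=
    (Set.mem_iInter₂.1 hx θ (by simpa using hθ1)).2
  have hlow := mul_floatingWidth_sub_le_logLaplace hK hsymm hvol hθ0 hδ (by linarith) hs0.le
  rw [← hus, Real.log_div hδ.ne' two_ne_zero] at hlow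
  have hin : inner ℝ ((2⁻¹ : ℝ) • x) u ≤ s * floatingWidth K δ θ / 2 := by
    rw [hus, real_inner_smul_left, real_inner_smul_right]
    have := mul_le_mul_of_nonneg_left ((le_abs_self _).trans hxθ) hs0.le
    linarith
  rw [one_div, Real.log_inv] at hr2 ⊢
  -- If `sT ≤ 2r`, then `Λ_K ≥ 0` suffices. Otherwise the cap bound gives `sT/2 - sT + r + log 2 ≤
  -- log 2 ≤ r`, using `δ < 1/2`.
  rcases le_total (s * floatingWidth K δ θ) (2 * -Real.log δ) with h | h <;> linarith

theorem mainTheorem11 :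
    ∃ c₁ c₂ : ℝ, 0 < c₁ ∧ 0 < c₂ ∧
      ∀ (n : ℕ) (K : ConvexBody (EuclideanSpace ℝ (Fin n))),
        (∀ x ∈ K, -x ∈ K) →
        volume (K : Set (EuclideanSpace ℝ (Fin n))) = 1 →
        ∀ δ : ℝ, 0 < δ → δ < 1 / 2 →
          c₁ • legendreLevelSet (K : Set (EuclideanSpace ℝ (Fin n))) (Real.log (1 / δ)) ⊆
              floatingBody (K : Set (EuclideanSpace ℝ (Fin n))) δ ∧
            floatingBody (K : Set (EuclideanSpace ℝ (Fin n))) δ ⊆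
              c₂ • legendreLevelSet (K : Set (EuclideanSpace ℝ (Fin n))) (Real.log (1 / δ)) := by
  refine ⟨1 / 9, 2, by norm_num, by norm_num, fun n K hsymm hvol δ hδ hδ2 => ⟨?_, ?_⟩⟩
  · exact smul_legendreLevelSet_subset_floatingBody K.isCompact K.convex hsymm hvol hδ hδ2
  · exact floatingBody_subset_smul_legendreLevelSet K.isCompact hsymm hvol hδ hδ2
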